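/- **Setting.** Let $n,m$ be natural numbers and $\mathcal I=\{XX,XY,XZ,YX,YY,YZ\}$. For each pixel $\xi\in\{1,\dots,n\}^2$ let $(k_X,k_Y,k_Z)[\xi]\in\mathbb R^3$ be a unit vector with $k_Z[\xi]\neq-1$, and let $$E_{XX}=1-\tfrac{k_X^2}{1+k_Z},\quad E_{XY}=E_{YX}=-\tfrac{k_Xk_Y}{1+k_Z},\quad E_{YY}=1-\tfrac{k_Y^2}{1+k_Z},\quad E_{XZ}=-k_X,\quad E_{YZ}=-k_Y$$ (all operations on arrays are element-wise). Let $\phi_d\in\mathbb R^{n\times n}$ and $r_d\in\mathbb R_+^{n\times n}$ for $d=1,\dots,m$, let $\mathcal F$ be the unitary two-dimensional discrete Fourier transform on $\mathbb C^{n\times n}$, and let $\mathcal H=(\mathbb C^{n\times n})^6$ and $\mathcal H^m$ carry the Frobenius norm. For $x=(x_c)_{c\in\mathcal I}\in\mathcal H$ put $$M_d(x)=\bigl(\mathcal F(x_c\cdot e^{j\phi_d})\bigr)_{c\in\mathcal I},\qquad \mathcal G_d(x)=\sqrt{\textstyle\sum_{c\in\mathcal I}|M_d(x)_c|^2},$$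 $$\Omega_0=\{(E_c\cdot z)_{c\in\mathcal I}: z\in\mathbb C^{n\times n}\},\qquad \Omega_d=\Bigl\{x\in\mathcal H:\ \textstyle\sum_{c\in\mathcal I}\bigl|\mathcal F(x_c\cdot e^{j\phi_d})\bigr|^2=r_d\Bigr\}\quad(d=1,\dots,m),$$ $$A=\{(x,\dots,x)\in\mathcal H^m: x\in\Omega_0\},\qquad B=\Omega_1\times\cdots\times\Omega_m .$$ It is not assumed that $A\cap B\ne\emptyset$. For a set $S$, $P_S(x)=\{w\in S:\|x-w\|=\operatorname{dist}(x,S)\}$ is the set-valued projector; $T_{AP}=P_AP_B$ is the set-valued alternating projection operator, and $\operatorname{Fix}T_{AP}=\{x: x\in T_{AP}(x)\}$. **Notions.** A set-valued map $T$ on $\mathcal H^m$ is *almost averaged on $U$ with violation $\varepsilon$ and averaging constant $\alpha$* if for all $y,z\in U$, $y^+\in T(y)$, $z^+\in T(z)$, $$\|z^+-y^+\|^2\le(1+\varepsilon)\|z-y\|^2-\tfrac{1-\alpha}{\alpha}\|(z^+-z)-(y^+-y)\|^2 .$$ A set-valued map $\Theta$ is *metrically subregular on $U$ for $\hat y$ relative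 to $\Lambda$ with modulus $\kappa>0$* if $\kappa\,\operatorname{dist}(x,\Theta^{-1}(\hat y)\cap\Lambda)\le\operatorname{dist}(\hat y,\Theta(x))$ for all $x\in U\cap\Lambda$. A sequence $(u_k)$ *converges linearly to $x$ with rate $c'\in(0,1)$* if there is $\gamma>0$ with $\|u_k-x\|\le\gamma\,c'^k$ for all $k\in\mathbb N$; it does so *with rate at most $c\in[0,1)$* if it converges linearly to $x$ with every rate $c'\in(0,1)$ with $c'\ge c$ (for $c>0$ this just means with rate $c$). **Theorem.** Let $\hat{\mathbf a}\in A$ be a fixed point of $T_{AP}$ and suppose that $P_B(\hat{\mathbf a})=\{\hat{\mathbf b}\}$ is a singleton, $\hat{\mathbf b}=(\hat x_1,\dots,\hat x_m)$, with $\mathcal G_d(\hat x_d)$ nonzero at every pixel for every $d=1,\dots,m$. Let $\varepsilon>0$ and let $U_\varepsilon(\hat{\mathbf b})$ be a neighborhood of $\hat{\mathbf b}$ on which $T_{AP}$ is almost averaged with violation $\varepsilon$ and averaging constant $2/3$. Suppose that $\hat{\mathbf a}\in U_\varepsilon(\hat{\mathbf b})$, that $T_{AP}(A\cap U_\varepsilon(\hat{\mathbf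 b}))\subset U_\varepsilon(\hat{\mathbf b})$, and that $\Theta=\mathrm{Id}-T_{AP}$ is metrically subregular on $U_\varepsilon(\hat{\mathbf b})$ for $0$ relative to $A$ with modulus $\kappa>\sqrt{2\varepsilon}$. Put $c=\sqrt{1+\varepsilon-\kappa^2/2}$ (with $c=0$ if the radicand is negative). Then $c<1$, and every sequence $(u_k)$ with $u_0\in A\cap U_\varepsilon(\hat{\mathbf b})$ and $u_{k+1}\in T_{AP}(u_k)$ for all $k$ converges linearly to a point of $\operatorname{Fix}T_{AP}$ with rate at most $c$. -/

import Mathlib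

open scoped Topology

noncomputable section

namespace HighNA

/-! ### Generic notions: projectors, set-valued maps, convergence -/

section Generic

variable {X : Type*} [NormedAddCommGroup X]

/-- The (set-valued) metric projector onto `S`. -/
def proj (S : Set X) (x : X) : Set X :=
  {w | w ∈ S ∧ ‖x - w‖ = Metric.infDist x S}

/-- The alternating projection operator `P_A P_B`, as a set-valued map. -/
def altProj (A B : Set X) (x : X) : Set X :=
  {y | ∃ b ∈ proj B x, y ∈ proj A b}

/-- The fixed point set of a set-valued self-map. -/
def fixSet (T : X → Set X) : Set X :=
  {x | x ∈ T x}

/-- The set-valued map `Id - T`. -/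
def idSub (T : X → Set X) (x : X) : Set X :=
  {z | ∃ y ∈ T x, z = x - y}

/-- `T` is pointwise almost averaged at `y` on `S` with violation `ε` and averaging
constant `α`. -/
def AlmostAveragedAt (T : X → Set X) (y : X) (S : Set X) (ε α : ℝ) : Prop :=
  ∀ yp ∈ T y, ∀ z ∈ S, ∀ zp ∈ T z,
    ‖zp - yp‖ ^ 2 ≤ (1 + ε) * ‖z - y‖ ^ 2 - (1 - α) / α * ‖(zp - z) - (yp - y)‖ ^ 2

/-- `T` is almost averaged on `S`: pointwise almost averaged on `S` at every point of `S`,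
with the same violation and averaging constant. -/
def AlmostAveragedOn (T : X → Set X) (S : Set X) (ε α : ℝ) : Prop :=
  ∀ y ∈ S, AlmostAveragedAt T y S ε α

/-- `Θ` is metrically subregular on `U` for `y` relative to `L` with modulus `κ`:
`κ · dist (x, Θ⁻¹(y) ∩ L) ≤ dist (y, Θ x)` for all `x ∈ U ∩ L`.
Distances are extended, so that the distance to the empty set is `∞`. -/
def MetricallySubregularOn (Θ : X → Set X) (U : Set X) (y : X) (L : Set X) (κ : ℝ) : Prop :=
  0 < κ ∧ ∀ x ∈ U ∩ L,
    ENNReal.ofReal κ * Metric.infEDist x ({z | y ∈ Θ z} ∩ L) ≤ Metric.infEDist y (Θ x)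

/-- `u` is an iterative sequence generated by `T`. -/
def IsIterate (T : X → Set X) (u : ℕ → X) : Prop :=
  ∀ k, u (k + 1) ∈ T (u k)

/-- `u` converges linearly to `x` with rate `c ∈ (0,1)`. -/
def ConvergesLinearly (u : ℕ → X) (x : X) (c : ℝ) : Prop :=
  0 < c ∧ c < 1 ∧ ∃ γ > 0, ∀ k, ‖u k - x‖ ≤ γ * c ^ k

/-- `u` converges linearly to `x` with rate at most `c`, where `0 ≤ c < 1`: it converges linearly
with every admissible rate `c' ≥ c`. For `0 < c < 1` this is linear convergence with rate `c`;
the quantifier only serves the degenerate value `c = 0`, which is not itself a rate. -/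
def ConvergesLinearlyRateAtMost (u : ℕ → X) (x : X) (c : ℝ) : Prop :=
  ∀ c', 0 < c' → c' < 1 → c ≤ c' → ConvergesLinearly u x c'

end Generic

/-! ### High-NA phase retrieval -/

/-- The index set of the six field components. -/
inductive Chan
  | XX | XY | XZ | YX | YY | YZ
  deriving DecidableEq

instance : Fintype Chan where
  elems := {.XX, .XY, .XZ, .YX, .YY, .YZ}
  complete := by intro c; cases c <;> decide

/-- Pixels of an `n × n` array. -/
abbrev Pixel (n : ℕ) := Fin n × Fin n

/-- `ℋ = (ℂ^{n×n})^6`, with the Frobenius (Hilbert) norm. -/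
abbrev Hspace (n : ℕ) := EuclideanSpace ℂ (Chan × Pixel n)

/-- The product Hilbert space `ℋ^m`. -/
abbrev Hprod (n m : ℕ) := PiLp 2 (fun _ : Fin m => Hspace n)

/-- The two-dimensional discrete Fourier transform, normalised to be unitary. -/
def dft2 {n : ℕ} (x : Pixel n → ℂ) (ξ : Pixel n) : ℂ :=
  (1 / (n : ℂ)) * ∑ η : Pixel n,
    Complex.exp (-(2 * Real.pi * Complex.I *
      (((ξ.1 : ℕ) : ℂ) * ((η.1 : ℕ) : ℂ) + ((ξ.2 : ℕ) : ℂ) * ((η.2 : ℕ) : ℂ)) / (n : ℂ))) * x η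

/-- The data of a high-NA phase retrieval problem with `m` images of size `n × n`:
the unit wave vector `(kX, kY, kZ)` at each pixel of the aperture, the phase diversities `φ d`
and the measured intensities `r d`. -/
structure Model (n m : ℕ) where
  kX : Pixel n → ℝ
  kY : Pixel n → ℝ
  kZ : Pixel n → ℝ
  unit_wave : ∀ ξ, kX ξ ^ 2 + kY ξ ^ 2 + kZ ξ ^ 2 = 1
  kZ_ne : ∀ ξ, 1 + kZ ξ ≠ 0
  φ : Fin m → Pixel n → ℝ
  r : Fin m → Pixel n → ℝ
  r_nonneg : ∀ d ξ, 0 ≤ r d ξ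

namespace Model

variable {n m : ℕ} (P : Model n m)

/-- The six pupil field components `E_c`. -/
def E : Chan → Pixel n → ℝ
  | .XX, ξ => 1 - P.kX ξ ^ 2 / (1 + P.kZ ξ)
  | .XY, ξ => -(P.kX ξ * P.kY ξ / (1 + P.kZ ξ))
  | .XZ, ξ => -P.kX ξ
  | .YX, ξ => -(P.kY ξ * P.kX ξ / (1 + P.kZ ξ))
  | .YY, ξ => 1 - P.kY ξ ^ 2 / (1 + P.kZ ξ)
  | .YZ, ξ => -P.kY ξ

/-- The operator `M_d : (x_c)_c ↦ (𝓕(x_c · e^{jφ_d}))_c`. -/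
def M (d : Fin m) (x : Hspace n) : Hspace n :=
  WithLp.toLp 2 fun p : Chan × Pixel n =>
    dft2 (fun η => x (p.1, η) * Complex.exp (Complex.I * (P.φ d η : ℂ))) p.2

/-- The real array `𝒢_d(x) = √(∑_c |M_d(x)_c|²)`. -/
def G (d : Fin m) (x : Hspace n) (ξ : Pixel n) : ℝ :=
  Real.sqrt (∑ c : Chan, ‖P.M d x (c, ξ)‖ ^ 2)

/-- The pupil constraint set `Ω₀ = {(E_c · z)_c | z ∈ ℂ^{n×n}}`. -/
def Omega0 : Set (Hspace n) :=
  {x | ∃ z : Pixel n → ℂ, ∀ c ξ, x (c, ξ) = (P.E c ξ : ℂ) * z ξ}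

/-- The intensity constraint set `Ω_d = {x | ∑_c |𝓕(x_c · e^{jφ_d})|² = r_d}`. -/
def Omega (d : Fin m) : Set (Hspace n) :=
  {x | ∀ ξ, ∑ c : Chan, ‖P.M d x (c, ξ)‖ ^ 2 = P.r d ξ}

/-- `A = {(x, …, x) ∈ ℋ^m | x ∈ Ω₀}`. -/
def A : Set (Hprod n m) :=
  {w | ∃ x ∈ P.Omega0, ∀ d, w d = x}

/-- `B = Ω₁ × ⋯ × Ω_m`. -/
def B : Set (Hprod n m) :=
  {w | ∀ d, w d ∈ P.Omega d}

/-- The alternating projection operator `T_AP = P_A P_B` of the model. -/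
def TAP : Hprod n m → Set (Hprod n m) :=
  altProj P.A P.B

end Model

end HighNA

end

/-!
Write `T = P_A P_B` and `f(x) = dist(x, B)`. The set `A` is a linear subspace, so Pythagoras gives,
for points of `A`, two inequalities with no restriction on where the points lie:

* descent: `f(x⁺)² + ‖x - x⁺‖² ≤ f(x)²` for `x⁺ ∈ T x`;
* a quadratic upper bound at fixed points: `f(x)² ≤ f(y)² + ‖x - y‖²` for `y ∈ T y`.

By descent, `f(u_k)` decreases to a limit `l` and the steps tend to zero, so metric subregularity
makes the distance from `u_k` to its nearest fixed point `y_k` tend to zero, and `f(y_k) → l`. Once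
`f(y_k) = l`, subregularity and the two inequalities give
`f(u_{k+1})² - l² ≤ (1 - κ²) (f(u_k)² - l²)`. Hence the steps decay geometrically with every ratio
`c'` in `(0, 1)` such that `1 - κ² ≤ c'²`. Since `c² ≥ 1 + ε - κ² / 2 ≥ 1 - κ²`, every `c' ≥ c` is
such a ratio. The limit is a fixed point because the graph of `T` is closed. The points `y_k` may
lie outside `U`, which is why the second inequality is needed for arbitrary fixed points.

That `f(y_k) = l` for large `k` follows from `finite_infDist_fixSet`: `f` takes only finitely many
values on `Fix T`. In the coordinates given by the unitary maps `M_d`, the set `B` is a product of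
spheres, and its projector rescales the components `L_i y` (`i` an image and a pixel) that do not
vanish. On the subspace of `A` where a prescribed set of components vanishes, the fixed points are
then critical points of a polynomial in the point and in auxiliary multipliers, and the value of the
polynomial there determines `f`. A polynomial over a field of characteristic zero has finitely many
critical values (`finite_critical_values`): in the function field of each component of its critical
locus its differential is zero, so that it is algebraic over the base field
(`isAlgebraic_of_kaehlerDifferential_D_eq_zero`).
-/

namespace HighNA

noncomputable section

/-! ### Critical values of polynomials -/

section CriticalValues

/-- For `a` transcendental, `K` is an extension of the perfect field `k(a)`, hence formally smooth
over it and over `k[X]`, where `X` acts as `a`. The first homology of the cotangent complex of `K`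
over `k[X]` therefore vanishes, so that `K ⊗ Ω[k[X]⁄k] → Ω[K⁄k]` is injective; it sends
`1 ⊗ dX ≠ 0` to `da`. -/
theorem isAlgebraic_of_kaehlerDifferential_D_eq_zero {k K : Type*} [Field k] [CharZero k]
    [Field K] [Algebra k K] [Algebra.EssFiniteType k K] {a : K}
    (h0 : KaehlerDifferential.D k K a = 0) : IsAlgebraic k a := by
  by_contra ha
  let : Algebra (Polynomial k) K := (Polynomial.aeval a).toAlgebra
  have halg : ∀ q : Polynomial k, algebraMap (Polynomial k) K q = Polynomial.aeval a q :=
    fun _ => rfl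
  have : IsScalarTower k (Polynomial k) K := IsScalarTower.of_algebraMap_eq fun c => by
    rw [halg, Polynomial.algebraMap_eq, Polynomial.aeval_C]
  have : FaithfulSMul (Polynomial k) K := by
    rw [faithfulSMul_iff_algebraMap_injective]
    exact transcendental_iff_injective.mp ha
  let := FractionRing.liftAlgebra (Polynomial k) K
  have := FractionRing.isScalarTower_liftAlgebra (Polynomial k) K
  have : IsScalarTower k (FractionRing (Polynomial k)) K :=
    IsScalarTower.of_algebraMap_eq fun c => by
      rw [IsScalarTower.algebraMap_apply k (Polynomial k) (FractionRing (Polynomial k)),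
        ← IsScalarTower.algebraMap_apply (Polynomial k) (FractionRing (Polynomial k)) K,
        ← IsScalarTower.algebraMap_apply k (Polynomial k) K]
  have : Algebra.EssFiniteType (FractionRing (Polynomial k)) K :=
    Algebra.EssFiniteType.of_comp k (FractionRing (Polynomial k)) K
  have : CharZero (FractionRing (Polynomial k)) :=
    charZero_of_injective_algebraMap
      (FaithfulSMul.algebraMap_injective k (FractionRing (Polynomial k)))
  have : Algebra.FormallySmooth (FractionRing (Polynomial k)) K := inferInstance
  have : Algebra.FormallySmooth (Polynomial k) (FractionRing (Polynomial k)) :=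
    .of_isLocalization (nonZeroDivisors _)
  have : Algebra.FormallySmooth (Polynomial k) K :=
    .comp _ (FractionRing (Polynomial k)) _
  have hinj : Function.Injective (KaehlerDifferential.mapBaseChange k (Polynomial k) K) := by
    rw [injective_iff_map_eq_zero]
    intro x hx
    obtain ⟨y, rfl⟩ := (Algebra.H1Cotangent.exact_δ_mapBaseChange k (Polynomial k) K x).mp hx
    have : Subsingleton (Algebra.H1Cotangent (Polynomial k) K) :=
      Algebra.FormallySmooth.subsingleton_h1Cotangent
    rw [Subsingleton.elim y 0, map_zero]
  have h1 : (1 : K) ⊗ₜ[Polynomial k] KaehlerDifferential.D k (Polynomial k) Polynomial.X = 0 := by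
    apply hinj
    rw [KaehlerDifferential.mapBaseChange_tmul, KaehlerDifferential.map_D, halg,
      Polynomial.aeval_X, h0, smul_zero, map_zero]
  have h2 := congrArg
    ((TensorProduct.rid (Polynomial k) K) ∘
      (LinearMap.lTensor K (KaehlerDifferential.polynomialEquiv k).toLinearMap)) h1
  simp at h2

/-- A polynomial in finitely many variables over a field of characteristic zero takes finitely many
values at its critical points. For each of the finitely many minimal primes `q` over the ideal of
the partial derivatives, the polynomial is algebraic over `k` modulo `q`; every critical point lies
on some `q`, and its value is then a root of one fixed univariate polynomial. -/
theorem finite_critical_values {k σ : Type*} [Field k] [CharZero k] [Finite σ]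
    (p : MvPolynomial σ k) :
    {c : k | ∃ x : σ → k, (∀ i, MvPolynomial.eval x (MvPolynomial.pderiv i p) = 0) ∧
      MvPolynomial.eval x p = c}.Finite := by
  classical
  cases nonempty_fintype σ
  set J : Ideal (MvPolynomial σ k) := Ideal.span (Set.range fun i => MvPolynomial.pderiv i p)
  have key : ∀ q ∈ J.minimalPrimes, ∃ f : Polynomial k, f ≠ 0 ∧ Polynomial.aeval p f ∈ q := by
    intro q hq
    have : q.IsPrime := hq.1.1
    have hJq : J ≤ q := hq.1.2
    set K := FractionRing (MvPolynomial σ k ⧸ q)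
    have htow : ∀ g : MvPolynomial σ k, algebraMap (MvPolynomial σ k) K g =
        algebraMap (MvPolynomial σ k ⧸ q) K (Ideal.Quotient.mk q g) := fun g =>
      IsScalarTower.algebraMap_apply (MvPolynomial σ k) (MvPolynomial σ k ⧸ q) K g
    have : Algebra.EssFiniteType (MvPolynomial σ k ⧸ q) K :=
      Algebra.EssFiniteType.of_isLocalization _ (nonZeroDivisors _)
    have : Algebra.EssFiniteType k K := Algebra.EssFiniteType.comp k (MvPolynomial σ k ⧸ q) K
    have hD : KaehlerDifferential.D k K (algebraMap (MvPolynomial σ k) K p) = 0 := by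
      rw [← KaehlerDifferential.map_D k k (MvPolynomial σ k) K p]
      rw [← (KaehlerDifferential.mvPolynomialBasis k σ).sum_repr
        (KaehlerDifferential.D k (MvPolynomial σ k) p), map_sum]
      refine Finset.sum_eq_zero fun i _ => ?_
      rw [map_smul, KaehlerDifferential.mvPolynomialBasis_repr_apply, ← algebraMap_smul K, htow,
        Ideal.Quotient.eq_zero_iff_mem.mpr (hJq (Ideal.subset_span ⟨i, rfl⟩)), map_zero, zero_smul]
    have halg : IsAlgebraic k (algebraMap (MvPolynomial σ k) K p) :=
      isAlgebraic_of_kaehlerDifferential_D_eq_zero hD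
    obtain ⟨f, hf0, hf⟩ := halg
    refine ⟨f, hf0, ?_⟩
    rw [Polynomial.aeval_algebraMap_apply, htow] at hf
    exact Ideal.Quotient.eq_zero_iff_mem.mp
      ((map_eq_zero_iff _ (IsFractionRing.injective (MvPolynomial σ k ⧸ q) K)).mp hf)
  choose! f hf0 hf using key
  refine ((Ideal.finite_minimalPrimes_of_isNoetherianRing _ J).biUnion
    fun q _ => (f q).roots.toFinset.finite_toSet).subset ?_
  rintro c ⟨x, hx, rfl⟩
  have hprime : (RingHom.ker (MvPolynomial.eval x)).IsPrime := RingHom.ker_isPrime _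
  have hle : J ≤ RingHom.ker (MvPolynomial.eval x) := by
    rw [Ideal.span_le]
    rintro _ ⟨i, rfl⟩
    exact hx i
  obtain ⟨q, hq, hqle⟩ := Ideal.exists_minimalPrimes_le hle
  refine Set.mem_biUnion hq ?_
  have h := hqle (hf q hq)
  rw [RingHom.mem_ker, Polynomial.aeval_def, Polynomial.hom_eval₂] at h
  simp only [Finset.mem_coe, Multiset.mem_toFinset, Polynomial.mem_roots (hf0 q hq),
    Polynomial.IsRoot.def]
  rw [← h, Polynomial.eval]
  congr 1
  ext c; simp

end CriticalValues

/-! ### Values of a quadratic form at points with multipliers -/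

section Lagrangian

open MvPolynomial

variable {J τ : Type*} [Fintype J] {V : Type*} [AddCommGroup V] [Module ℝ V]

/-- The quadratic form `v ↦ Q v v` as a polynomial in the coordinates of `v` with respect to the
basis `β`; the type `τ` indexes further variables, which do not occur. -/
def quadPoly (τ : Type*) (β : Module.Basis J ℝ V) (Q : LinearMap.BilinForm ℝ V) :
    MvPolynomial (J ⊕ τ) ℝ :=
  ∑ j, ∑ k, C (Q (β j) (β k)) * (X (Sum.inl j) * X (Sum.inl k))

theorem sum_repr_mul_left (β : Module.Basis J ℝ V) (Q : LinearMap.BilinForm ℝ V) (w v : V) :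
    ∑ k, Q w (β k) * β.repr v k = Q w v := by
  conv_rhs => rw [← β.sum_repr v, map_sum]
  exact Finset.sum_congr rfl fun k _ => by rw [map_smul, smul_eq_mul, mul_comm]

theorem eval_quadPoly (β : Module.Basis J ℝ V) (Q : LinearMap.BilinForm ℝ V) (v : V)
    (y : τ → ℝ) : eval (Sum.elim (β.repr v) y) (quadPoly τ β Q) = Q v v := by
  have h : ∀ j, ∑ k, Q (β j) (β k) * (β.repr v j * β.repr v k) = β.repr v j * Q (β j) v := by
    intro j
    rw [← sum_repr_mul_left β Q (β j) v, Finset.mul_sum]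
    exact Finset.sum_congr rfl fun k _ => by ring
  simp only [quadPoly, map_sum, map_mul, eval_C, eval_X, Sum.elim_inl, h]
  conv_rhs => rw [← LinearMap.flip_apply, ← β.sum_repr v, map_sum]
  refine Finset.sum_congr rfl fun k _ => ?_
  rw [map_smul, smul_eq_mul, LinearMap.flip_apply, β.sum_repr]

theorem eval_pderiv_inl_quadPoly (β : Module.Basis J ℝ V) (Q : LinearMap.BilinForm ℝ V)
    (hQ : ∀ v w, Q v w = Q w v) (v : V) (y : τ → ℝ) (l : J) :
    eval (Sum.elim (β.repr v) y) (pderiv (Sum.inl l) (quadPoly τ β Q)) = 2 * Q (β l) v := by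
  classical
  have h : ∀ j k, eval (Sum.elim (β.repr v) y) (pderiv (Sum.inl l : J ⊕ τ)
      (C (Q (β j) (β k)) * (X (Sum.inl j) * X (Sum.inl k)))) =
      (if k = l then Q (β j) (β l) * β.repr v j else 0) +
        (if j = l then Q (β l) (β k) * β.repr v k else 0) := by
    intro j k
    have hX : ∀ a : J, pderiv (Sum.inl l) (X (Sum.inl a) : MvPolynomial (J ⊕ τ) ℝ) =
        if a = l then 1 else 0 := by
      intro a
      simp [pderiv_X, Pi.single_apply, eq_comm]
    by_cases hj : j = l <;> by_cases hk : k = l <;>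
      simp [Derivation.leibniz, hX, hj, hk]
    ring
  simp only [quadPoly, map_sum, h, Finset.sum_add_distrib, Finset.sum_ite_eq', Finset.mem_univ,
    if_true]
  rw [Finset.sum_comm (f := fun j k => if j = l then Q (β l) (β k) * β.repr v k else 0)]
  simp only [Finset.sum_ite_eq', Finset.mem_univ, if_true, hQ _ (β l), sum_repr_mul_left]
  ring

theorem pderiv_inr_quadPoly (β : Module.Basis J ℝ V) (Q : LinearMap.BilinForm ℝ V) (i : τ) :
    pderiv (Sum.inr i) (quadPoly τ β Q) = 0 := by
  classical
  simp [quadPoly, Derivation.leibniz, pderiv_X]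

/-- The conditions say that `(v, t, s)` is a critical point of the polynomial
`Q₀(v) - 2 ∑ ρᵢ tᵢ + ∑ sᵢ (tᵢ² - Qᵢ(v))`, in which the norm `√(Qᵢ(v))` is represented by the variable
`tᵢ` with multiplier `sᵢ`; the value of this polynomial there is `-Q₀(v)`. -/
theorem finite_values_of_multipliers {I : Type*} [Fintype I] [FiniteDimensional ℝ V]
    (Q₀ : LinearMap.BilinForm ℝ V) (hQ₀ : ∀ v w, Q₀ v w = Q₀ w v)
    (Q : I → LinearMap.BilinForm ℝ V) (hQ : ∀ i v w, Q i v w = Q i w v) (ρ : I → ℝ) :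
    {c : ℝ | ∃ (v : V) (s t : I → ℝ), (∀ w, Q₀ w v = ∑ i, s i * Q i w v) ∧
      (∀ i, t i ^ 2 = Q i v v) ∧ (∀ i, s i * t i = ρ i) ∧ Q₀ v v = c}.Finite := by
  classical
  set β := Module.finBasis ℝ V
  let p : MvPolynomial (Fin (Module.finrank ℝ V) ⊕ (I ⊕ I)) ℝ :=
    quadPoly (I ⊕ I) β Q₀ - ∑ i, C (2 * ρ i) * X (Sum.inr (Sum.inl i)) +
      ∑ i, X (Sum.inr (Sum.inr i)) *
        (X (Sum.inr (Sum.inl i)) ^ 2 - quadPoly (I ⊕ I) β (Q i))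
  refine ((finite_critical_values p).image Neg.neg).subset ?_
  rintro _ ⟨v, s, t, hv, ht, hs, rfl⟩
  refine ⟨- Q₀ v v, ⟨Sum.elim (β.repr v) (Sum.elim t s), ?_, ?_⟩, neg_neg _⟩
  · rintro (l | i | i)
    · simp [p, Derivation.leibniz, pderiv_X, Derivation.leibniz_pow,
        eval_pderiv_inl_quadPoly β _ hQ₀, eval_pderiv_inl_quadPoly β _ (hQ _), hv, Finset.mul_sum]
      rw [add_neg_eq_zero]
      exact Finset.sum_congr rfl fun i _ => by ring
    · simp [p, Derivation.leibniz, pderiv_X, Pi.single_apply, Derivation.leibniz_pow,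
        pderiv_inr_quadPoly, ← hs]
      ring
    · simp [p, Derivation.leibniz, pderiv_X, Pi.single_apply, Derivation.leibniz_pow,
        pderiv_inr_quadPoly, eval_quadPoly, ht]
  · simp [p, eval_quadPoly, ht, ← hs]
    have h : ∑ i, 2 * (s i * t i) * t i = 2 * Q₀ v v := by
      rw [hv, Finset.mul_sum]
      exact Finset.sum_congr rfl fun i _ => by rw [← ht]; ring
    rw [h]
    ring

end Lagrangian

/-! ### Projections onto subspaces and onto products of spheres -/

section Projections

variable {X : Type*} [NormedAddCommGroup X]

theorem norm_sub_le_of_mem_proj {S : Set X} {x w z : X} (hw : w ∈ proj S x) (hz : z ∈ S) :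
    ‖x - w‖ ≤ ‖x - z‖ := by
  rw [hw.2, ← dist_eq_norm]
  exact Metric.infDist_le_dist_of_mem hz

variable [InnerProductSpace ℂ X]

theorem inner_eq_zero_of_mem_proj {K : Submodule ℂ X} {x w : X} (hw : w ∈ proj (K : Set X) x) :
    ∀ z ∈ K, inner ℂ (x - w) z = 0 := by
  refine (K.norm_eq_iInf_iff_inner_eq_zero hw.1).mp ?_
  rw [hw.2, Metric.infDist_eq_iInf]
  simp only [dist_eq_norm]
  rfl

theorem norm_sub_sq_of_mem_proj {K : Submodule ℂ X} {x w z : X} (hw : w ∈ proj (K : Set X) x)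
    (hz : z ∈ K) : ‖x - z‖ ^ 2 = ‖x - w‖ ^ 2 + ‖w - z‖ ^ 2 := by
  have h := inner_eq_zero_of_mem_proj hw (w - z) (K.sub_mem hw.1 hz)
  have h2 := norm_add_sq_eq_norm_sq_add_norm_sq_of_inner_eq_zero _ _ h
  rw [sub_add_sub_cancel] at h2
  linarith

variable {I F : Type*} [Fintype I] [NormedAddCommGroup F] [InnerProductSpace ℂ F]

/-- The points whose image under `L` has its `i`-th component on the sphere of squared radius
`r i`, for every `i`. -/
def sphereProduct (L : X ≃ₗᵢ[ℂ] PiLp 2 fun _ : I => F) (r : I → ℝ) : Set X :=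
  {w | ∀ i, ‖L w i‖ ^ 2 = r i}

/-- A point of `sphereProduct L r` nearest to `y` has components that are nonnegative multiples of
those of `y`, wherever the latter do not vanish. -/
theorem norm_smul_eq_of_mem_proj_sphereProduct {L : X ≃ₗᵢ[ℂ] PiLp 2 fun _ : I => F} {r : I → ℝ}
    {y b : X} (hb : b ∈ proj (sphereProduct L r) y) (i : I) :
    ‖L y i‖ • L b i = ‖L b i‖ • L y i := by
  classical
  let : InnerProductSpace ℝ F := InnerProductSpace.complexToReal
  by_cases hy : L y i = 0
  · simp [hy]
  have hy' : ‖L y i‖ ≠ 0 := norm_ne_zero_iff.mpr hy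
  -- Replacing the `i`-th component of `b` by its aligned version `p` stays in the set and cannot
  -- bring the point closer to `y`; this is the equality case of the Cauchy–Schwarz inequality.
  set p : F := (‖L b i‖ / ‖L y i‖) • L y i with hp
  have hpn : ‖p‖ = ‖L b i‖ := by
    rw [hp, norm_smul, Real.norm_of_nonneg (by positivity), div_mul_cancel₀ _ hy']
  set b' : X := L.symm (WithLp.toLp 2 (Function.update (L b) i p)) with hb'
  have hLb' : ∀ j, L b' j = Function.update (⇑(L b)) i p j := fun j => by simp [hb']
  have hmem : b' ∈ sphereProduct L r := by
    intro j
    rw [hLb', ← hb.1 j]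
    by_cases hj : j = i
    · subst hj
      rw [Function.update_self, hpn]
    · rw [Function.update_of_ne hj]
  have hle := norm_sub_le_of_mem_proj hb hmem
  have hle2 : ∑ j, ‖L y j - L b j‖ ^ 2 ≤ ∑ j, ‖L y j - L b' j‖ ^ 2 := by
    have h1 : ∀ w, ∑ j, ‖L y j - L w j‖ ^ 2 = ‖y - w‖ ^ 2 := fun w => by
      rw [← L.norm_map (y - w), PiLp.norm_sq_eq_of_L2]
      simp
    rw [h1, h1]
    gcongr
  rw [← Finset.add_sum_erase _ _ (Finset.mem_univ i),
    ← Finset.add_sum_erase _ (fun j => ‖L y j - L b' j‖ ^ 2) (Finset.mem_univ i)] at hle2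
  have hrest : ∑ j ∈ Finset.univ.erase i, ‖L y j - L b' j‖ ^ 2 =
      ∑ j ∈ Finset.univ.erase i, ‖L y j - L b j‖ ^ 2 :=
    Finset.sum_congr rfl fun j hj => by
      rw [hLb', Function.update_of_ne (Finset.ne_of_mem_erase hj)]
  rw [hrest, hLb', Function.update_self, add_le_add_iff_right] at hle2
  refine (inner_eq_norm_mul_iff_real (F := F)).mp (le_antisymm (real_inner_le_norm _ _) ?_)
  have e1 := norm_sub_sq_real (L y i) (L b i)
  have e2 := norm_sub_sq_real (L y i) p
  rw [hpn, hp, inner_smul_right, real_inner_self_eq_norm_sq] at e2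
  have e3 : ‖L b i‖ / ‖L y i‖ * ‖L y i‖ ^ 2 = ‖L y i‖ * ‖L b i‖ := by field_simp
  rw [e3] at e2
  rw [hp, e1, e2] at hle2
  rw [real_inner_comm]
  linarith

/-- The distance to a product of spheres takes finitely many values at the fixed points of the
alternating projections onto it and a subspace. At a fixed point `y` with `b` the point of `B`
chosen, `‖y - b‖² = ∑ r i - ‖y‖²`, and `⟪w, y⟫ = ⟪w, b⟫` for `w ∈ K`. If `w` vanishes in the
components where `y` does, the right-hand side is a combination of the `⟪L w i, L y i⟫` with the
coefficients `√(r i) / ‖L y i‖`, so that `finite_values_of_multipliers` applies. -/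
theorem finite_infDist_fixSet [FiniteDimensional ℂ X] (K : Submodule ℂ X)
    (L : X ≃ₗᵢ[ℂ] PiLp 2 fun _ : I => F) (r : I → ℝ) :
    ((fun y => Metric.infDist y (sphereProduct L r)) ''
      fixSet (altProj (K : Set X) (sphereProduct L r))).Finite := by
  classical
  let : InnerProductSpace ℝ X := InnerProductSpace.complexToReal
  let : InnerProductSpace ℝ F := InnerProductSpace.complexToReal
  have : FiniteDimensional ℝ X := FiniteDimensional.complexToReal X
  -- `V Z` is the part of `K` on which the components in `Z` vanish.
  let V (Z : Finset I) : Submodule ℝ X :=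
    { carrier := {v | v ∈ K ∧ ∀ i ∈ Z, L v i = 0}
      zero_mem' := ⟨K.zero_mem, fun i _ => by simp⟩
      add_mem' := fun {v w} hv hw =>
        ⟨K.add_mem hv.1 hw.1, fun i hi => by simp [hv.2 i hi, hw.2 i hi]⟩
      smul_mem' := fun c v hv => by
        rw [← Complex.coe_smul]
        exact ⟨K.smul_mem _ hv.1, fun i hi => by rw [map_smul, PiLp.smul_apply, hv.2 i hi, smul_zero]⟩ }
  let f (Z : Finset I) (i : I) : V Z →ₗ[ℝ] F :=
    { toFun := fun v => L (v : X) i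
      map_add' := fun v w => by simp
      map_smul' := fun c v => by
        rw [Submodule.coe_smul, ← Complex.coe_smul, map_smul]
        simp }
  have hfin := fun Z : Finset I => finite_values_of_multipliers (V := V Z)
    ((innerₗ X).compl₁₂ (V Z).subtype (V Z).subtype)
    (fun v w => real_inner_comm (F := X) w v)
    (fun i => (innerₗ F).compl₁₂ (f Z i) (f Z i))
    (fun i v w => real_inner_comm (F := F) (f Z i w) (f Z i v)) (fun i => if i ∈ Z then 0 else Real.sqrt (r i))
  refine (Set.finite_iUnion fun Z =>
    (hfin Z).image fun c => Real.sqrt (∑ i, r i - c)).subset ?_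
  rintro _ ⟨y, ⟨b, hb, hy⟩, rfl⟩
  set Z : Finset I := {i | L y i = 0} with hZ
  have hmemZ : ∀ i, i ∈ Z ↔ L y i = 0 := fun i => by simp [hZ]
  have hyV : y ∈ V Z := ⟨hy.1, fun i hi => (hmemZ i).mp hi⟩
  have hbn : ∀ i, ‖L b i‖ = Real.sqrt (r i) := fun i => by
    rw [← hb.1 i, Real.sqrt_sq (norm_nonneg _)]
  refine Set.mem_iUnion.mpr ⟨Z, ‖y‖ ^ 2, ⟨⟨y, hyV⟩,
    fun i => if i ∈ Z then 0 else Real.sqrt (r i) / ‖L y i‖, fun i => ‖L y i‖, ?_, ?_, ?_, ?_⟩, ?_⟩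
  · rintro ⟨w, hw⟩
    change inner ℝ w y = ∑ i, _ * inner ℝ (L w i) (L y i)
    have h1 : inner ℝ w y = inner ℝ w b := by
      have h := inner_eq_zero_of_mem_proj hy w hw.1
      rw [← sub_eq_zero, ← inner_sub_right, ← neg_sub b y, inner_neg_right, real_inner_comm]
      rw [real_inner_eq_re_inner ℂ, h]
      simp
    have h2 : inner ℝ w b = ∑ i, inner ℝ (L w i) (L b i) := by
      rw [real_inner_eq_re_inner ℂ, ← L.inner_map_map, PiLp.inner_apply, map_sum]
      simp only [real_inner_eq_re_inner ℂ]
    rw [h1, h2]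
    refine Finset.sum_congr rfl fun i _ => ?_
    by_cases hi : i ∈ Z
    · simp [hw.2 i hi]
    · have hne : ‖L y i‖ ≠ 0 := norm_ne_zero_iff.mpr fun h => hi ((hmemZ i).mpr h)
      have h3 := norm_smul_eq_of_mem_proj_sphereProduct hb i
      rw [if_neg hi, div_mul_eq_mul_div, eq_div_iff hne, ← hbn, ← real_inner_smul_right, ← h3,
        real_inner_smul_right, mul_comm]
  · intro i
    exact (real_inner_self_eq_norm_sq (L y i)).symm
  · intro i
    by_cases hi : i ∈ Z
    · simp [hi]
    · have hne : ‖L y i‖ ≠ 0 := norm_ne_zero_iff.mpr fun h => hi ((hmemZ i).mpr h)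
      simp [hi, div_mul_cancel₀ _ hne]
  · exact real_inner_self_eq_norm_sq y
  · have h1 := norm_sub_sq_of_mem_proj hy K.zero_mem
    rw [sub_zero, sub_zero, ← L.norm_map b, PiLp.norm_sq_eq_of_L2,
      Finset.sum_congr rfl fun i _ => hb.1 i] at h1
    change Real.sqrt (∑ i, r i - ‖y‖ ^ 2) = _
    rw [h1, add_sub_cancel_right, Real.sqrt_sq (norm_nonneg _), norm_sub_rev, hb.2]

end Projections

/-! ### Convergence of alternating projections -/

section Dynamics

open Filter Metric

variable {X : Type*} [NormedAddCommGroup X]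

theorem mem_proj_of_tendsto {B : Set X} (hB : IsClosed B) {u b : ℕ → X} {x y : X}
    (hu : Tendsto u atTop (𝓝 x)) (hb : Tendsto b atTop (𝓝 y)) (h : ∀ k, b k ∈ proj B (u k)) :
    y ∈ proj B x := by
  refine ⟨hB.mem_of_tendsto hb (Eventually.of_forall fun k => (h k).1), ?_⟩
  refine tendsto_nhds_unique (hu.sub hb).norm ?_
  simp only [(h _).2]
  exact ((continuous_infDist_pt B).tendsto x).comp hu

/-- The graph of the alternating projection operator of two closed sets is closed. -/
theorem mem_altProj_of_tendsto [ProperSpace X] {A B : Set X} (hA : IsClosed A) (hB : IsClosed B)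
    {u v : ℕ → X} {x y : X} (hu : Tendsto u atTop (𝓝 x)) (hv : Tendsto v atTop (𝓝 y))
    (h : ∀ k, v k ∈ altProj A B (u k)) : y ∈ altProj A B x := by
  choose b hb hvb using h
  have hdist : Tendsto (fun k => infDist (u k) B) atTop (𝓝 (infDist x B)) :=
    ((continuous_infDist_pt B).tendsto x).comp hu
  obtain ⟨C, hC⟩ := (hu.norm.add hdist).bddAbove_range
  have hbound : ∀ k, b k ∈ closedBall (0 : X) C := fun k => by
    rw [mem_closedBall_zero_iff]
    calc ‖b k‖ = ‖u k - (u k - b k)‖ := by rw [sub_sub_cancel]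
      _ ≤ ‖u k‖ + ‖u k - b k‖ := norm_sub_le _ _
      _ = ‖u k‖ + infDist (u k) B := by rw [(hb k).2]
      _ ≤ C := hC ⟨k, rfl⟩
  obtain ⟨z, -, φ, hφ, hz⟩ := tendsto_subseq_of_bounded isBounded_closedBall hbound
  exact ⟨z, mem_proj_of_tendsto hB (hu.comp hφ.tendsto_atTop) hz fun k => hb (φ k),
    mem_proj_of_tendsto hA hz (hv.comp hφ.tendsto_atTop) fun k => hvb (φ k)⟩

theorem mul_infDist_fixSet_le {T : X → Set X} {U L : Set X} {κ : ℝ}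
    (hsub : MetricallySubregularOn (idSub T) U 0 L κ) (hL : fixSet T ⊆ L)
    {x y : X} (hx : x ∈ U ∩ L) (hy : y ∈ T x) :
    κ * infDist x (fixSet T) ≤ ‖x - y‖ := by
  have hset : {z | (0 : X) ∈ idSub T z} ∩ L = fixSet T := by
    ext z
    constructor
    · rintro ⟨⟨w, hw, h0⟩, -⟩
      rw [eq_comm, sub_eq_zero] at h0
      subst h0
      exact hw
    · exact fun hz => ⟨⟨z, hz, (sub_self z).symm⟩, hL hz⟩
  have h1 := hsub.2 x hx
  rw [hset] at h1
  have h2 : infEDist (0 : X) (idSub T x) ≤ ENNReal.ofReal ‖x - y‖ := by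
    have hmem : x - y ∈ idSub T x := ⟨y, hy, rfl⟩
    refine (infEDist_le_edist_of_mem hmem).trans_eq ?_
    rw [edist_dist, dist_eq_norm, zero_sub, norm_neg]
  have h3 := ENNReal.toReal_mono ENNReal.ofReal_ne_top (h1.trans h2)
  rwa [ENNReal.toReal_mul, ENNReal.toReal_ofReal hsub.1.le,
    ENNReal.toReal_ofReal (norm_nonneg _)] at h3

variable [InnerProductSpace ℂ X] {K : Submodule ℂ X} {B : Set X}

theorem infDist_sq_add_norm_sq_le_of_mem_altProj {x y : X} (hx : x ∈ K)
    (hy : y ∈ altProj (K : Set X) B x) :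
    infDist y B ^ 2 + ‖x - y‖ ^ 2 ≤ infDist x B ^ 2 := by
  obtain ⟨b, hb, hyb⟩ := hy
  have h1 := norm_sub_sq_of_mem_proj hyb hx
  have h2 : infDist y B ≤ ‖b - y‖ := by
    rw [norm_sub_rev, ← dist_eq_norm]
    exact infDist_le_dist_of_mem hb.1
  have h3 : infDist y B ^ 2 ≤ ‖b - y‖ ^ 2 := by
    gcongr
    exact infDist_nonneg
  rw [← hb.2, norm_sub_rev x b, h1, norm_sub_rev x y]
  linarith

/-- A fixed point `y = P_K b` lies between `b ∈ B` and all of `K` in the sense of Pythagoras, so that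
the squared distance to `B` grows at most quadratically around `y`. -/
theorem infDist_sq_le_of_mem_fixSet {x y : X} (hx : x ∈ K)
    (hy : y ∈ fixSet (altProj (K : Set X) B)) :
    infDist x B ^ 2 ≤ infDist y B ^ 2 + ‖x - y‖ ^ 2 := by
  obtain ⟨b, hb, hyb⟩ := hy
  have h1 := norm_sub_sq_of_mem_proj hyb hx
  have h2 : infDist x B ≤ ‖b - x‖ := by
    rw [norm_sub_rev, ← dist_eq_norm]
    exact infDist_le_dist_of_mem hb.1
  have h3 : infDist x B ^ 2 ≤ ‖b - x‖ ^ 2 := by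
    gcongr
    exact infDist_nonneg
  rw [← hb.2, norm_sub_rev y b, norm_sub_rev x y]
  linarith

/-- Linear convergence of alternating projections under an error bound along the sequence, when the
distance to `B` has finitely many values at fixed points. -/
theorem exists_convergesLinearly_of_finite_infDist [FiniteDimensional ℂ X] (hB : IsClosed B)
    (hfin : ((fun y => infDist y B) '' fixSet (altProj (K : Set X) B)).Finite)
    (hne : (fixSet (altProj (K : Set X) B)).Nonempty) {κ : ℝ} (hκ : 0 < κ) {u : ℕ → X}
    (hu : IsIterate (altProj (K : Set X) B) u) (hu0 : u 0 ∈ K)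
    (herr : ∀ k, κ * infDist (u k) (fixSet (altProj (K : Set X) B)) ≤ ‖u k - u (k + 1)‖) :
    ∃ x ∈ fixSet (altProj (K : Set X) B),
      ∀ c, 0 < c → c < 1 → 1 - κ ^ 2 ≤ c ^ 2 → ConvergesLinearly u x c := by
  have : ProperSpace X := FiniteDimensional.proper ℂ X
  have hK : IsClosed (K : Set X) := K.closed_of_finiteDimensional
  have huK : ∀ k, u k ∈ K := by
    rintro (_ | k)
    · exact hu0
    · obtain ⟨b, -, hb⟩ := hu k
      exact hb.1
  have hfix_closed : IsClosed (fixSet (altProj (K : Set X) B)) := by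
    refine isClosed_of_closure_subset fun x hx => ?_
    obtain ⟨v, hv, hvx⟩ := mem_closure_iff_seq_limit.mp hx
    exact mem_altProj_of_tendsto hK hB hvx hvx hv
  choose y hy hyd using fun k => hfix_closed.exists_infDist_eq_dist hne (u k)
  have hdesc : ∀ k, infDist (u (k + 1)) B ^ 2 + ‖u k - u (k + 1)‖ ^ 2 ≤ infDist (u k) B ^ 2 :=
    fun k => infDist_sq_add_norm_sq_le_of_mem_altProj (huK k) (hu k)
  have hanti : Antitone fun k => infDist (u k) B := antitone_nat_of_succ_le fun k =>
    le_of_sq_le_sq (by nlinarith [hdesc k, sq_nonneg ‖u k - u (k + 1)‖]) infDist_nonneg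
  obtain ⟨l, hl⟩ : ∃ l, Tendsto (fun k => infDist (u k) B) atTop (𝓝 l) :=
    ⟨_, tendsto_atTop_ciInf hanti ⟨0, by rintro _ ⟨k, rfl⟩; exact infDist_nonneg⟩⟩
  have hl0 : 0 ≤ l := ge_of_tendsto' hl fun k => infDist_nonneg
  have hlle : ∀ k, l ≤ infDist (u k) B := fun k => hanti.le_of_tendsto hl k
  have hstep0 : Tendsto (fun k => ‖u k - u (k + 1)‖) atTop (𝓝 0) := by
    have h1 : Tendsto (fun k => infDist (u k) B ^ 2 - infDist (u (k + 1)) B ^ 2) atTop (𝓝 0) := by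
      have := (hl.pow 2).sub ((hl.comp (tendsto_add_atTop_nat 1)).pow 2)
      rwa [sub_self] at this
    have h2 : Tendsto (fun k => ‖u k - u (k + 1)‖ ^ 2) atTop (𝓝 0) :=
      squeeze_zero (fun k => sq_nonneg _) (fun k => by linarith [hdesc k]) h1
    simpa [Real.sqrt_sq (norm_nonneg _)] using h2.sqrt
  have herr' : ∀ k, κ * dist (u k) (y k) ≤ ‖u k - u (k + 1)‖ := fun k => hyd k ▸ herr k
  have hdist0 : Tendsto (fun k => dist (u k) (y k)) atTop (𝓝 0) := by
    refine squeeze_zero (fun k => dist_nonneg) (fun k => ?_) (by simpa using hstep0.const_mul κ⁻¹)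
    rw [inv_mul_eq_div, le_div_iff₀' hκ]
    exact herr' k
  have hyl : Tendsto (fun k => infDist (y k) B) atTop (𝓝 l) := by
    have h1 : Tendsto (fun k => infDist (y k) B - infDist (u k) B) atTop (𝓝 0) :=
      squeeze_zero_norm (fun k => by
        rw [← dist_eq_norm, dist_comm]
        exact (lipschitz_infDist_pt B).dist_le_mul _ _ |>.trans (by simp)) hdist0
    simpa using h1.add hl
  -- A sequence in a finite set of reals can only converge by reaching its limit.
  have hev : ∀ᶠ k in atTop, infDist (y k) B = l := by
    have hopen : ((fun y => infDist y B) '' fixSet (altProj (K : Set X) B) \ {l})ᶜ ∈ 𝓝 l :=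
      (hfin.subset Set.sdiff_subset).isClosed.isOpen_compl.mem_nhds (by simp)
    filter_upwards [hyl hopen] with k hk
    by_contra hne
    exact hk ⟨⟨y k, hy k, rfl⟩, hne⟩
  obtain ⟨N, hN⟩ := eventually_atTop.mp hev
  have hgap : ∀ k, N ≤ k →
      κ ^ 2 * (infDist (u k) B ^ 2 - l ^ 2) ≤ ‖u k - u (k + 1)‖ ^ 2 := fun k hk => by
    have h1 := infDist_sq_le_of_mem_fixSet (huK k) (hy k)
    rw [hN k hk, ← dist_eq_norm] at h1
    calc κ ^ 2 * (infDist (u k) B ^ 2 - l ^ 2) ≤ κ ^ 2 * dist (u k) (y k) ^ 2 := by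
          gcongr; linarith
      _ = (κ * dist (u k) (y k)) ^ 2 := by ring
      _ ≤ _ := by gcongr; exact herr' k
  -- `hgap` and the descent inequality contract `f² - l²` by the factor `1 - κ²` from `N` on; the
  -- constant `C` absorbs the first `N` steps.
  have hgeo : ∀ c, 0 < c → 1 - κ ^ 2 ≤ c ^ 2 →
      ∃ C, ∀ k, dist (u k) (u (k + 1)) ≤ C * c ^ k := fun c hc0 hc => by
    set δ : ℕ → ℝ := fun k => infDist (u k) B ^ 2 - l ^ 2 with hδ
    have hδ0 : ∀ k, 0 ≤ δ k := fun k => sub_nonneg.mpr (by have := hlle k; gcongr)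
    have hδs : ∀ k, N ≤ k → δ (k + 1) ≤ c ^ 2 * δ k := fun k hk => by
      have := mul_le_mul_of_nonneg_right hc (hδ0 k)
      have h1 := hgap k hk
      have h2 := hdesc k
      simp only [hδ] at this ⊢
      linarith
    have hδg : ∀ j, δ (N + j) ≤ (c ^ j) ^ 2 * δ N := fun j => by
      induction j with
      | zero => simp
      | succ j ih =>
        calc δ (N + j + 1) ≤ c ^ 2 * δ (N + j) := hδs _ (by omega)
          _ ≤ c ^ 2 * ((c ^ j) ^ 2 * δ N) := by gcongr
          _ = (c ^ (j + 1)) ^ 2 * δ N := by ring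
    have htail : ∀ j, dist (u (N + j)) (u (N + j + 1)) ≤ Real.sqrt (δ N) * c ^ j := fun j => by
      rw [dist_eq_norm]
      refine le_of_sq_le_sq ?_ (by positivity)
      rw [mul_pow, Real.sq_sqrt (hδ0 N)]
      have h1 := hδg j
      have h2 := hdesc (N + j)
      have h3 := hδ0 (N + j + 1)
      simp only [hδ] at h1 h3 ⊢
      linarith
    refine ⟨∑ k ∈ Finset.range N, dist (u k) (u (k + 1)) / c ^ k + Real.sqrt (δ N) / c ^ N,
      fun k => ?_⟩
    have hs : ∀ k, 0 ≤ dist (u k) (u (k + 1)) / c ^ k := fun k => by positivity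
    rw [← div_le_iff₀ (by positivity)]
    rcases lt_or_ge k N with hk | hk
    · have := Finset.single_le_sum (fun k _ => hs k) (Finset.mem_range.mpr hk)
      have : 0 ≤ Real.sqrt (δ N) / c ^ N := by positivity
      linarith
    · obtain ⟨j, rfl⟩ := Nat.exists_eq_add_of_le hk
      have h1 := htail j
      have h2 : dist (u (N + j)) (u (N + j + 1)) / c ^ (N + j) ≤ Real.sqrt (δ N) / c ^ N := by
        rw [div_le_div_iff₀ (by positivity) (by positivity), pow_add]
        calc _ ≤ Real.sqrt (δ N) * c ^ j * c ^ N := by gcongr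
          _ = _ := by ring
      have := Finset.sum_nonneg fun k (_ : k ∈ Finset.range N) => hs k
      linarith
  -- One admissible ratio, positive also when `1 - κ ^ 2 ≤ 0`, shows that the limit exists.
  obtain ⟨c₀, hc₀, hc₀1, hc₀κ⟩ : ∃ c, 0 < c ∧ c < 1 ∧ 1 - κ ^ 2 ≤ c ^ 2 := by
    refine ⟨Real.sqrt (max (1 - κ ^ 2) (1 / 4)), by positivity, ?_, ?_⟩
    · rw [Real.sqrt_lt' one_pos]
      exact max_lt (by nlinarith) (by norm_num)
    · rw [Real.sq_sqrt (by positivity)]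
      exact le_max_left _ _
  obtain ⟨C₀, hC₀⟩ := hgeo c₀ hc₀ hc₀κ
  obtain ⟨x, hx⟩ := cauchySeq_tendsto_of_complete (cauchySeq_of_le_geometric c₀ C₀ hc₀1 hC₀)
  refine ⟨x, mem_altProj_of_tendsto hK hB hx (hx.comp (tendsto_add_atTop_nat 1)) hu,
    fun c hc0 hc1 hc => ⟨hc0, hc1, ?_⟩⟩
  obtain ⟨C, hC⟩ := hgeo c hc0 hc
  have hbd := dist_le_of_le_geometric_of_tendsto c C hc1 hC hx
  refine ⟨|C| / (1 - c) + 1, by have := sub_pos.mpr hc1; positivity, fun k => ?_⟩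
  rw [← dist_eq_norm]
  have h1c := sub_pos.mpr hc1
  calc dist (u k) x ≤ C * c ^ k / (1 - c) := hbd k
    _ ≤ |C| * c ^ k / (1 - c) := by gcongr; exact le_abs_self C
    _ = |C| / (1 - c) * c ^ k := by ring
    _ ≤ (|C| / (1 - c) + 1) * c ^ k := by gcongr; linarith

end Dynamics

/-! ### Unitarity of the discrete Fourier transform -/

section Fourier

open Matrix

variable {n : ℕ}

/-- The matrix of the one-dimensional discrete Fourier transform, without normalisation. -/
def dftMatrix (n : ℕ) : Matrix (Fin n) (Fin n) ℂ :=
  fun a b => Complex.exp (-(2 * Real.pi * Complex.I / n)) ^ ((a : ℕ) * (b : ℕ))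

theorem dftMatrix_conjTranspose_mul_self (n : ℕ) :
    (dftMatrix n)ᴴ * dftMatrix n = (n : ℂ) • (1 : Matrix (Fin n) (Fin n) ℂ) := by
  ext a b
  have hn : n ≠ 0 := (a.pos).ne'
  have hζ := Complex.isPrimitiveRoot_exp n hn
  set ζ := Complex.exp (2 * Real.pi * Complex.I / n) with hζd
  have hζ0 : ζ ≠ 0 := Complex.exp_ne_zero _
  have hinv : Complex.exp (-(2 * Real.pi * Complex.I / n)) = ζ⁻¹ := Complex.exp_neg _
  have hconj : star ζ⁻¹ = ζ := by
    rw [← hinv, Complex.star_def, ← Complex.exp_conj, hζd]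
    congr 1
    simp [neg_div, Complex.conj_ofNat]
  set z : ℂ := ζ ^ (a : ℕ) * ζ⁻¹ ^ (b : ℕ) with hz
  have hterm : ∀ k : Fin n, (dftMatrix n)ᴴ a k * dftMatrix n k b = z ^ (k : ℕ) := fun k => by
    rw [conjTranspose_apply, dftMatrix, dftMatrix, hinv, star_pow, hconj, hz, mul_pow, ← pow_mul,
      ← pow_mul, mul_comm (k : ℕ), mul_comm (k : ℕ)]
  rw [mul_apply, Finset.sum_congr rfl fun k _ => hterm k,
    Fin.sum_univ_eq_sum_range (fun k => z ^ k) n, Matrix.smul_apply, smul_eq_mul]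
  by_cases hab : a = b
  · subst hab
    have hz1 : z = 1 := by rw [hz, ← mul_pow, mul_inv_cancel₀ hζ0, one_pow]
    simp [hz1]
  · have hz1 : z ≠ 1 := fun h => by
      rw [hz, inv_pow, mul_inv_eq_one₀ (pow_ne_zero _ hζ0)] at h
      exact hab (Fin.ext (hζ.pow_inj a.2 b.2 h))
    have hzn : z ^ n = 1 := by
      rw [hz, mul_pow, ← pow_mul, ← pow_mul, mul_comm (a : ℕ), mul_comm (b : ℕ), pow_mul, pow_mul,
        inv_pow, hζ.pow_eq_one]
      simp
    rw [one_apply_ne hab, mul_zero]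
    have h := geom_sum_mul z n
    rw [hzn, sub_self] at h
    exact (mul_eq_zero.mp h).resolve_right (sub_ne_zero.mpr hz1)

theorem dft2_eq_mulVec (x : Pixel n → ℂ) :
    dft2 x = ((1 / (n : ℂ)) • kroneckerMap (· * ·) (dftMatrix n) (dftMatrix n)) *ᵥ x := by
  ext ξ
  rw [dft2, smul_mulVec, Pi.smul_apply, smul_eq_mul]
  congr 1
  refine Finset.sum_congr rfl fun η _ => ?_
  change _ = kroneckerMap (· * ·) (dftMatrix n) (dftMatrix n) ξ η * x η
  rw [kroneckerMap_apply, dftMatrix, dftMatrix, ← pow_add, ← Complex.exp_nat_mul]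
  congr 2
  push_cast
  ring

theorem dft2_add (x y : Pixel n → ℂ) : dft2 (x + y) = dft2 x + dft2 y := by
  rw [dft2_eq_mulVec, dft2_eq_mulVec, dft2_eq_mulVec, Matrix.mulVec_add]

theorem dft2_smul (c : ℂ) (x : Pixel n → ℂ) : dft2 (c • x) = c • dft2 x := by
  rw [dft2_eq_mulVec, dft2_eq_mulVec, Matrix.mulVec_smul]

/-- Parseval's identity for the normalised two-dimensional discrete Fourier transform. -/
theorem sum_norm_sq_dft2 (x : Pixel n → ℂ) : ∑ ξ, ‖dft2 x ξ‖ ^ 2 = ∑ η, ‖x η‖ ^ 2 := by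
  have hnorm : ∀ y : Pixel n → ℂ, ((∑ ξ, ‖y ξ‖ ^ 2 : ℝ) : ℂ) = star y ⬝ᵥ y := fun y => by
    rw [dotProduct, Complex.ofReal_sum]
    refine Finset.sum_congr rfl fun ξ _ => ?_
    rw [Pi.star_apply, Complex.star_def, ← Complex.normSq_eq_conj_mul_self,
      Complex.normSq_eq_norm_sq]
  rw [← Complex.ofReal_inj, hnorm, hnorm, dft2_eq_mulVec, star_mulVec, dotProduct_mulVec,
    vecMul_vecMul, conjTranspose_smul, Matrix.smul_mul, Matrix.mul_smul, conjTranspose_kronecker,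
    ← mul_kronecker_mul, dftMatrix_conjTranspose_mul_self]
  rcases Nat.eq_zero_or_pos n with rfl | hn
  · simp [dotProduct]
  · have : (n : ℂ) ≠ 0 := by exact_mod_cast hn.ne'
    rw [smul_kronecker, kronecker_smul, one_kronecker_one, smul_smul, smul_smul, smul_smul]
    have h1 : (n : ℂ)⁻¹ * (n : ℂ)⁻¹ * n * n = 1 := by field_simp
    simp [h1]

end Fourier

/-! ### The high-NA phase retrieval model -/

namespace Model

variable {n m : ℕ} (P : Model n m)

theorem M_add (d : Fin m) (x y : Hspace n) : P.M d (x + y) = P.M d x + P.M d y := by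
  ext p
  have h := congrFun (dft2_add (fun η => x (p.1, η) * Complex.exp (Complex.I * (P.φ d η : ℂ)))
    (fun η => y (p.1, η) * Complex.exp (Complex.I * (P.φ d η : ℂ)))) p.2
  simp only [M, PiLp.add_apply, add_mul]
  exact h

theorem M_smul (d : Fin m) (c : ℂ) (x : Hspace n) : P.M d (c • x) = c • P.M d x := by
  ext p
  have h := congrFun (dft2_smul c
    (fun η => x (p.1, η) * Complex.exp (Complex.I * (P.φ d η : ℂ)))) p.2
  simp only [M, PiLp.smul_apply, smul_eq_mul, mul_assoc]
  exact h

theorem sum_norm_sq_M (d : Fin m) (x : Hspace n) : ∑ p, ‖P.M d x p‖ ^ 2 = ‖x‖ ^ 2 := by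
  rw [EuclideanSpace.norm_sq_eq, Fintype.sum_prod_type, Fintype.sum_prod_type]
  refine Finset.sum_congr rfl fun c _ => (sum_norm_sq_dft2 fun η =>
    x (c, η) * Complex.exp (Complex.I * (P.φ d η : ℂ))).trans ?_
  refine Finset.sum_congr rfl fun η _ => ?_
  rw [norm_mul, mul_comm Complex.I, Complex.norm_exp_ofReal_mul_I, mul_one]

/-- The operators `M_d`, for all `d` together, as a unitary map; its value is sorted by image and
pixel, so that each component collects the six field components that enter one intensity. -/
def fieldEquiv : Hprod n m ≃ₗᵢ[ℂ] PiLp 2 fun _ : Fin m × Pixel n => EuclideanSpace ℂ Chan :=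
  LinearIsometry.toLinearIsometryEquiv
    { toFun := fun w => WithLp.toLp 2 fun i => WithLp.toLp 2 fun c => P.M i.1 (w i.1) (c, i.2)
      map_add' := fun v w => by ext i c; simp [M_add]
      map_smul' := fun a v => by ext i c; simp [M_smul]
      norm_map' := fun w => by
        rw [← sq_eq_sq₀ (norm_nonneg _) (norm_nonneg _), PiLp.norm_sq_eq_of_L2,
          PiLp.norm_sq_eq_of_L2, Fintype.sum_prod_type]
        refine Finset.sum_congr rfl fun d _ => ?_
        rw [← P.sum_norm_sq_M d]
        refine Eq.trans ?_ (Fintype.sum_prod_type_right _).symm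
        exact Finset.sum_congr rfl fun ξ _ => EuclideanSpace.norm_sq_eq
          (WithLp.toLp 2 fun c => P.M d (w d) (c, ξ)) }
    (by
      rw [(WithLp.linearEquiv 2 ℂ _).finrank_eq, (WithLp.linearEquiv 2 ℂ _).finrank_eq,
        Module.finrank_pi_fintype, Module.finrank_pi_fintype]
      simp
      ring)

theorem fieldEquiv_apply (w : Hprod n m) (i : Fin m × Pixel n) (c : Chan) :
    P.fieldEquiv w i c = P.M i.1 (w i.1) (c, i.2) := rfl

theorem B_eq_sphereProduct : P.B = sphereProduct P.fieldEquiv fun i => P.r i.1 i.2 := by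
  ext w
  simp only [B, Omega, sphereProduct, Set.mem_ofPred_eq, EuclideanSpace.norm_sq_eq,
    fieldEquiv_apply, Prod.forall]

/-- The constraint set `A` as a linear subspace. -/
def ASubmodule : Submodule ℂ (Hprod n m) where
  carrier := P.A
  zero_mem' := ⟨0, ⟨0, fun c ξ => by simp⟩, fun d => rfl⟩
  add_mem' := by
    rintro v w ⟨x, ⟨z, hz⟩, hv⟩ ⟨y, ⟨z', hz'⟩, hw⟩
    exact ⟨x + y, ⟨z + z', fun c ξ => by simp [hz, hz', mul_add]⟩, fun d => by simp [hv, hw]⟩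
  smul_mem' := by
    rintro a v ⟨x, ⟨z, hz⟩, hv⟩
    exact ⟨a • x, ⟨a • z, fun c ξ => by simp [hz, mul_left_comm]⟩, fun d => by simp [hv]⟩

theorem isClosed_B : IsClosed P.B := by
  rw [B_eq_sphereProduct, sphereProduct, Set.ofPred_forall]
  refine isClosed_iInter fun i => isClosed_eq ?_ continuous_const
  exact ((PiLp.continuous_apply 2 _ i).comp P.fieldEquiv.continuous).norm.pow 2

end Model
end

end HighNA

theorem mainTheorem1 (n m : ℕ) (P : HighNA.Model n m)
    (a b : HighNA.Hprod n m)
    (haA : a ∈ P.A) (hafix : a ∈ HighNA.fixSet P.TAP)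
    (hab : HighNA.proj P.B a = {b})
    (hG : ∀ (d : Fin m) (ξ : HighNA.Pixel n), P.G d (b d) ξ ≠ 0)
    (ε : ℝ) (hε : 0 < ε)
    (U : Set (HighNA.Hprod n m)) (hU : U ∈ 𝓝 b)
    (havg : HighNA.AlmostAveragedOn P.TAP U ε (2 / 3))
    (haU : a ∈ U)
    (hinv : ∀ x ∈ P.A ∩ U, P.TAP x ⊆ U)
    (κ : ℝ) (hκ : Real.sqrt (2 * ε) < κ)
    (hsub : HighNA.MetricallySubregularOn (HighNA.idSub P.TAP) U 0 P.A κ) :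
    Real.sqrt (1 + ε - κ ^ 2 / 2) < 1 ∧
    ∀ u : ℕ → HighNA.Hprod n m, HighNA.IsIterate P.TAP u → u 0 ∈ P.A ∩ U →
      ∃ x ∈ HighNA.fixSet P.TAP,
        HighNA.ConvergesLinearlyRateAtMost u x (Real.sqrt (1 + ε - κ ^ 2 / 2)) := by
  have hκε : 2 * ε < κ ^ 2 := (Real.sqrt_lt' hsub.1).mp hκ
  refine ⟨by rw [Real.sqrt_lt' one_pos]; linarith, fun u hu hu0 => ?_⟩
  have huU : ∀ k, u k ∈ P.A ∩ U := by
    intro k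
    induction k with
    | zero => exact hu0
    | succ k ih =>
      refine ⟨?_, hinv _ ih (hu k)⟩
      obtain ⟨b, -, hb⟩ := hu k
      exact hb.1
  have hfixA : HighNA.fixSet P.TAP ⊆ P.A := by
    rintro x ⟨b, -, hb⟩
    exact hb.1
  have hfin := HighNA.finite_infDist_fixSet P.ASubmodule P.fieldEquiv fun i => P.r i.1 i.2
  rw [← P.B_eq_sphereProduct] at hfin
  obtain ⟨x, hx, hconv⟩ := HighNA.exists_convergesLinearly_of_finite_infDist (K := P.ASubmodule)
    P.isClosed_B hfin ⟨a, hafix⟩ hsub.1 hu hu0.1 fun k =>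
      HighNA.mul_infDist_fixSet_le hsub hfixA ⟨(huU k).2, (huU k).1⟩ (hu k)
  refine ⟨x, hx, fun c hc0 hc1 hc => hconv c hc0 hc1 ?_⟩
  -- `c² ≥ 1 + ε - κ² / 2 ≥ 1 - κ²`, because `κ ^ 2 / 2` and `ε` are nonnegative.
  have h1 : 1 + ε - κ ^ 2 / 2 ≤ c ^ 2 := (Real.sqrt_le_left hc0.le).mp hc
  linarith
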